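/- Let $\mathcal H_A,\mathcal H_B$ be finite-dimensional complex Hilbert spaces, and write $\rho_A=\operatorname{tr}_B\rho_{AB}$ for the partial trace. For a finite-dimensional Hilbert space $\mathcal H$ let $S_=(\mathcal H)$ be the set of positive semi-definite operators of trace $1$ on $\mathcal H$, and $S_\le(\mathcal H)$ the set of positive semi-definite operators $\rho$ with $0<\operatorname{tr}\rho\le 1$. For $\rho,\sigma\in S_\le(\mathcal H)$ let $F(\rho,\sigma)=\|\sqrt\rho\sqrt\sigma\|_1+\sqrt{(1-\operatorname{tr}\rho)(1-\operatorname{tr}\sigma)}$ be the generalized fidelity, where $\|O\|_1=\operatorname{tr}\sqrt{O^\dagger O}$, let $P(\rho,\sigma)=\sqrt{1-F(\rho,\sigma)^2}$ be the purified distance, and let $\mathcal B^\varepsilon(\rho)=\{\rho'\in S_\le(\mathcal H):P(\rho,\rho')\le\varepsilon\}$. For positive semi-definite $\rho,\sigma$ let $D_{\max}(\rho\|\sigma)=\inf\{\lambda\in\mathbb R: 2^\lambda\sigma\ge\rho\}$ (equal to $+\infty$ if there is no such $\lambda$). Define, for $\tau\in S_\le(\mathcal H_A\otimes\mathcal H_B)$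 and $\omega\in S_\le(\mathcal H_A)$, $$H_{\min}(A|B)_\tau=-\inf_{\sigma_B\in S_=(\mathcal H_B)}D_{\max}(\tau_{AB}\|\mathbb I_A\otimes\sigma_B),\qquad H_{\min}(A)_\omega=-\log_2\lambda_{\max}(\omega),$$ $${}^2I_{\max}(A:B)_\tau=\inf_{\sigma_B\in S_=(\mathcal H_B)}D_{\max}(\tau_{AB}\|\tau_A\otimes\sigma_B),$$ where $\lambda_{\max}(\omega)$ is the largest eigenvalue of $\omega$, and the smooth versions $$H_{\min}^\varepsilon(A|B)_\rho=\sup_{\rho'\in\mathcal B^\varepsilon(\rho_{AB})}H_{\min}(A|B)_{\rho'},\qquad H_{\min}^\varepsilon(A)_\rho=\sup_{\omega\in\mathcal B^\varepsilon(\rho_A)}H_{\min}(A)_{\omega},\qquad {}^2I_{\max}^\varepsilon(A:B)_\rho=\inf_{\rho'\in\mathcal B^\varepsilon(\rho_{AB})}{}^2I_{\max}(A:B)_{\rho'}.$$ Let $\rho=\rho_{AB}\in S_=(\mathcal H_A\otimes\mathcal H_B)$ and let $\varepsilon\ge 0$ satisfy $4\sqrt{2\varepsilon}<1$. Then the three quantities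 below are finite real numbers, and $${}^2I_{\max}^{\varepsilon}(A:B)_\rho\;\ge\;H_{\min}^{\varepsilon}(A)_\rho-H_{\min}^{4\sqrt{2\varepsilon}}(A|B)_\rho .$$ -/

import Mathlib

open scoped Kronecker ComplexOrder MatrixOrder

noncomputable section

namespace QInfo

/- A finite-dimensional Hilbert space with a fixed orthonormal basis indexed by `n` is `ℂ ^ n`;
its operators are the square complex matrices indexed by `n`, and the operators on the tensor
product of `ℂ ^ A` and `ℂ ^ B` are the matrices indexed by `A × B`. -/

/-- Normalized density operators: positive semi-definite with trace one. -/
def normalizedStates (n : Type*) [Fintype n] : Set (Matrix n n ℂ) :=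
  {ρ | ρ.PosSemidef ∧ ρ.trace = 1}

/-- Subnormalized density operators: positive semi-definite with trace in `(0, 1]`
(the trace of a positive semi-definite matrix is real). -/
def subnormalizedStates (n : Type*) [Fintype n] : Set (Matrix n n ℂ) :=
  {ρ | ρ.PosSemidef ∧ 0 < ρ.trace.re ∧ ρ.trace.re ≤ 1}

/-- The reduced operator on `A`, that is, the partial trace over `B`. -/
def reduceA {A B : Type*} [Fintype B] (M : Matrix (A × B) (A × B) ℂ) : Matrix A A ℂ :=
  Matrix.of fun a a' => ∑ b, M (a, b) (a', b)

/-- The trace norm `tr √(O† O)`. -/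
def traceNorm {n : Type*} [Fintype n] [DecidableEq n] (O : Matrix n n ℂ) : ℝ :=
  (CFC.sqrt (O.conjTranspose * O)).trace.re

/-- The generalized fidelity `‖√ρ √σ‖₁ + √((1 - tr ρ) (1 - tr σ))`. -/
def fidelity {n : Type*} [Fintype n] [DecidableEq n] (ρ σ : Matrix n n ℂ) : ℝ :=
  traceNorm (CFC.sqrt ρ * CFC.sqrt σ) + √((1 - ρ.trace.re) * (1 - σ.trace.re))

/-- The purified distance `√(1 - F(ρ, σ)²)`. -/
def purifiedDistance {n : Type*} [Fintype n] [DecidableEq n] (ρ σ : Matrix n n ℂ) : ℝ :=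
  √(1 - fidelity ρ σ ^ 2)

/-- The subnormalized states whose purified distance from `ρ` is at most `ε`. -/
def stateBall {n : Type*} [Fintype n] [DecidableEq n] (ε : ℝ) (ρ : Matrix n n ℂ) :
    Set (Matrix n n ℂ) :=
  {ρ' | ρ' ∈ subnormalizedStates n ∧ purifiedDistance ρ ρ' ≤ ε}

/-- The max-relative entropy: the least real `lam` with `2 ^ lam • σ ≥ ρ`
(it is `⊤` if there is no such `lam`, that is, if the support of `ρ` is not contained in
that of `σ`). -/
def maxRelEntropy {n : Type*} [Fintype n] (ρ σ : Matrix n n ℂ) : EReal :=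
  ⨅ (lam : ℝ) (_ : (((2 : ℝ) ^ lam) • σ - ρ).PosSemidef), (lam : EReal)

/-- The conditional min-entropy `H_min(A|B)_ρ`. -/
def condMinEntropy {A B : Type*} [Fintype A] [DecidableEq A] [Fintype B]
    (ρ : Matrix (A × B) (A × B) ℂ) : EReal :=
  -(⨅ σ ∈ normalizedStates B, maxRelEntropy ρ ((1 : Matrix A A ℂ) ⊗ₖ σ))

/-- The smooth conditional min-entropy `H_min^ε(A|B)_ρ`. -/
def smoothCondMinEntropy {A B : Type*} [Fintype A] [DecidableEq A] [Fintype B] [DecidableEq B]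
    (ε : ℝ) (ρ : Matrix (A × B) (A × B) ℂ) : EReal :=
  ⨆ ρ' ∈ stateBall ε ρ, condMinEntropy ρ'

/-- The min-entropy `-log₂ λ_max(ρ)` of a state on a single system, where `λ_max(ρ)` is the
largest eigenvalue of `ρ`. -/
def minEntropy {n : Type*} [Fintype n] [DecidableEq n] (ρ : Matrix n n ℂ) : ℝ :=
  -Real.logb 2 (sSup (spectrum ℝ ρ))

/-- The smooth min-entropy of a state on a single system. -/
def smoothMinEntropy {n : Type*} [Fintype n] [DecidableEq n] (ε : ℝ) (ρ : Matrix n n ℂ) : EReal :=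
  ⨆ ρ' ∈ stateBall ε ρ, (minEntropy ρ' : EReal)

/-- The max-information `²I_max(A:B)_ρ`: the first marginal is that of `ρ`, the second one is
optimized over. -/
def maxInfo₂ {A B : Type*} [Fintype A] [Fintype B]
    (ρ : Matrix (A × B) (A × B) ℂ) : EReal :=
  ⨅ σ ∈ normalizedStates B, maxRelEntropy ρ (reduceA ρ ⊗ₖ σ)

/-- The smooth max-information `²I_max^ε(A:B)_ρ`. -/
def smoothMaxInfo₂ {A B : Type*} [Fintype A] [DecidableEq A] [Fintype B] [DecidableEq B]
    (ε : ℝ) (ρ : Matrix (A × B) (A × B) ℂ) : EReal :=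
  ⨅ ρ' ∈ stateBall ε ρ, maxInfo₂ ρ'

end QInfo

end

open scoped Matrix

namespace QInfo

set_option linter.unusedSectionVars false

variable {n : Type*} [Fintype n] [DecidableEq n]
variable {A B : Type*} [Fintype A] [DecidableEq A] [Fintype B] [DecidableEq B]

/-! ### Functional calculus of Hermitian matrices -/

/-! Fix ρ' near ρ, ω near ρ_A, and σ, λ with ρ' ≤ 2^λ ρ'_A ⊗ σ, and let μ be the largest eigenvalue
of ω. A function G of ρ'_A lowers to μ every eigenvalue above μ, in the sense that G ρ'_A G ≤ μ.
With K = G ⊗ 1 this gives K ρ' K ≤ 2^λ μ (1 ⊗ σ), so K ρ' K has conditional min-entropy at least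
H_min(ω) - λ. Taking the supremum over ω and the infimum over ρ', σ, λ yields the theorem, provided
K ρ' K lies in the larger ball around ρ.

That is the content of `exists_filter`. Up to the Frobenius distance between √ρ' and a purification
of ρ, which is O(ε), the overlap of ρ with K ρ' K is tr(G ρ'_A). By `exists_capping` the loss tr ρ'
- tr(G ρ'_A) is at most tr P(ρ'_A - ω), where P is the spectral projection of ρ'_A above μ: capping
costs little because ω ≤ μ and ω is close to ρ'_A. A Fuchs–van de Graaf estimate bounds this by 6ε.
The fidelity is then 1 - O(ε), hence the purified distance is O(√ε).

Finiteness follows from trace comparisons and the pinching inequality. -/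

lemma continuousOn_spectrum (f : ℝ → ℝ) (H : Matrix n n ℂ) : ContinuousOn f (spectrum ℝ H) :=
  H.finite_real_spectrum.continuousOn f

lemma cfc_mul_matrix (f g : ℝ → ℝ) (H : Matrix n n ℂ) :
    cfc (fun x => f x * g x) H = cfc f H * cfc g H :=
  cfc_mul f g H (continuousOn_spectrum f H) (continuousOn_spectrum g H)

lemma conjTranspose_cfc (f : ℝ → ℝ) (H : Matrix n n ℂ) : (cfc f H)ᴴ = cfc f H :=
  (cfc_predicate f H : IsSelfAdjoint (cfc f H))

lemma cfc_mul_self_right (f : ℝ → ℝ) {H : Matrix n n ℂ} (hH : H.IsHermitian) :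
    cfc f H * H = cfc (fun x => f x * x) H := by
  rw [cfc_mul_matrix f (fun x => x), cfc_id' ℝ H hH.isSelfAdjoint]

/-! ### Traces and contractions -/

lemma trace_re_nonneg {M : Matrix n n ℂ} (hM : 0 ≤ M) : 0 ≤ M.trace.re :=
  (Complex.nonneg_iff.mp (Matrix.nonneg_iff_posSemidef.mp hM).trace_nonneg).1

lemma trace_re_mono {M N : Matrix n n ℂ} (h : M ≤ N) : M.trace.re ≤ N.trace.re := by
  have := trace_re_nonneg (sub_nonneg.mpr h)
  rw [Matrix.trace_sub, Complex.sub_re] at this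
  linarith

lemma trace_re_conjTranspose (M : Matrix n n ℂ) : Mᴴ.trace.re = M.trace.re := by
  rw [Matrix.trace_conjTranspose]; simp

lemma conj_nonneg {m : Type*} [Fintype m] {M : Matrix n n ℂ} (hM : 0 ≤ M) (K : Matrix m n ℂ) :
    0 ≤ K * M * Kᴴ :=
  Matrix.nonneg_iff_posSemidef.mpr
    ((Matrix.nonneg_iff_posSemidef.mp hM).mul_mul_conjTranspose_same K)

lemma conj_mono {m : Type*} [Fintype m] {M N : Matrix n n ℂ} (h : M ≤ N) (K : Matrix m n ℂ) :
    K * M * Kᴴ ≤ K * N * Kᴴ := by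
  have := conj_nonneg (sub_nonneg.mpr h) K
  rwa [Matrix.mul_sub, Matrix.sub_mul, sub_nonneg] at this

lemma mul_conjTranspose_nonneg {m : Type*} [Fintype m] (K : Matrix n m ℂ) : 0 ≤ K * Kᴴ :=
  Matrix.nonneg_iff_posSemidef.mpr (Matrix.posSemidef_self_mul_conjTranspose K)

lemma conjTranspose_sqrt (M : Matrix n n ℂ) : (CFC.sqrt M)ᴴ = CFC.sqrt M :=
  (IsSelfAdjoint.of_nonneg (CFC.sqrt_nonneg M) : IsSelfAdjoint (CFC.sqrt M))

lemma trace_re_mul_nonneg {M N : Matrix n n ℂ} (hM : 0 ≤ M) (hN : 0 ≤ N) :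
    0 ≤ (M * N).trace.re := by
  have h := trace_re_nonneg (conj_nonneg hM (CFC.sqrt N))
  rwa [conjTranspose_sqrt, Matrix.trace_mul_comm, ← mul_assoc, CFC.sqrt_mul_sqrt_self N hN,
    Matrix.trace_mul_comm] at h

lemma trace_re_mul_mono {P M N : Matrix n n ℂ} (hP : 0 ≤ P) (h : M ≤ N) :
    (P * M).trace.re ≤ (P * N).trace.re := by
  have := trace_re_mul_nonneg hP (sub_nonneg.mpr h)
  rw [mul_sub, Matrix.trace_sub, Complex.sub_re] at this
  linarith

/-- A contraction: an operator `K` with `K K† ≤ 1`. -/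
def IsContraction (K : Matrix n n ℂ) : Prop := K * Kᴴ ≤ 1

lemma IsContraction.mul {K L : Matrix n n ℂ} (hK : IsContraction K) (hL : IsContraction L) :
    IsContraction (K * L) := by
  have h := conj_mono hL K
  have e : K * L * (K * L)ᴴ = K * (L * Lᴴ) * Kᴴ := by
    simp only [Matrix.conjTranspose_mul, mul_assoc]
  rw [IsContraction, e]
  rw [mul_one] at h
  exact h.trans hK

lemma isContraction_of_projection {K P : Matrix n n ℂ} (h : K * Kᴴ = P) (hP : P * P = P) :
    IsContraction K := by
  have hPh : Pᴴ = P := by rw [← h]; simp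
  have := mul_conjTranspose_nonneg (1 - P)
  rw [Matrix.conjTranspose_sub, Matrix.conjTranspose_one, hPh, mul_sub, mul_one, sub_mul, one_mul,
    hP, sub_self, sub_zero, sub_nonneg] at this
  rwa [IsContraction, h]

/-- The sum (1 - K)(1 - K)† + (1 - K K†) = 2 - K - K† is positive; pair it with H. -/
lemma IsContraction.trace_re_mul_le {K H : Matrix n n ℂ} (hK : IsContraction K) (hH : 0 ≤ H) :
    (K * H).trace.re ≤ H.trace.re := by
  have h1 : 0 ≤ (1 - K) * (1 - K)ᴴ + (1 - K * Kᴴ) :=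
    add_nonneg (mul_conjTranspose_nonneg _) (sub_nonneg.mpr hK)
  have e : (1 - K) * (1 - K)ᴴ + (1 - K * Kᴴ) = 1 + 1 - K - Kᴴ := by
    rw [Matrix.conjTranspose_sub, Matrix.conjTranspose_one]; noncomm_ring
  have h2 := trace_re_mul_nonneg h1 hH
  have h3 : (Kᴴ * H).trace.re = (K * H).trace.re := by
    rw [← trace_re_conjTranspose, Matrix.conjTranspose_mul, Matrix.conjTranspose_conjTranspose,
      (Matrix.nonneg_iff_posSemidef.mp hH).1.eq, Matrix.trace_mul_comm]
  rw [e, sub_mul, sub_mul, add_mul, one_mul] at h2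
  simp only [Matrix.trace_sub, Matrix.trace_add, Complex.sub_re, Complex.add_re, h3] at h2
  linarith

/-- Polar decomposition of a square root `X` of `H ^ 2`, with a partial isometry. -/
lemma exists_polar {H X : Matrix n n ℂ} (hH : H.IsHermitian) (h : X * Xᴴ = H * H) :
    ∃ V, X = H * V ∧ V * Xᴴ = H ∧ IsContraction V ∧ IsContraction Vᴴ := by
  -- Since 0⁻¹ = 0, J is the Moore–Penrose inverse of H and H J is the projection onto the range of
  -- H.
  set f : ℝ → ℝ := fun x => x⁻¹
  set J := cfc f H
  have hJ : Jᴴ = J := conjTranspose_cfc f H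
  have hcomm : H * J = J * H := by
    have := (Commute.cfc_real (Commute.refl H) f).eq
    exact this.symm
  have hJHJ : J * H * J = J := by
    rw [cfc_mul_self_right f hH, ← cfc_mul_matrix]
    refine cfc_congr fun x _ => ?_
    by_cases hx : x = 0 <;> simp [f, hx]
  have hHJH : H * J * H = H := by
    rw [hcomm, cfc_mul_self_right f hH, cfc_mul_self_right _ hH]
    conv_rhs => rw [← cfc_id' ℝ H hH.isSelfAdjoint]
    refine cfc_congr fun x _ => ?_
    by_cases hx : x = 0 <;> simp [f, hx]
  -- The part of X outside the range of H vanishes, since its square is (1 - H J) H² (1 - J H) = 0.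
  have hX : X = H * (J * X) := by
    have hz : (X - H * J * X) * (X - H * J * X)ᴴ = 0 := by
      have : (X - H * J * X) * (X - H * J * X)ᴴ = (1 - H * J) * (X * Xᴴ) * (1 - J * H) := by
        simp only [Matrix.conjTranspose_sub, Matrix.conjTranspose_mul, hJ, hH.eq]
        noncomm_ring
      rw [this, h, ← mul_assoc (1 - H * J), sub_mul (1 : Matrix n n ℂ), one_mul, hHJH, sub_self,
        zero_mul, zero_mul]
    have := (Matrix.self_mul_conjTranspose_eq_zero).mp hz
    rw [← mul_assoc]
    exact sub_eq_zero.mp this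
  refine ⟨J * X, hX, ?_, isContraction_of_projection (P := J * H) ?_ ?_,
    isContraction_of_projection (P := Xᴴ * J * J * X) ?_ ?_⟩
  · rw [mul_assoc, h, ← mul_assoc, ← hcomm, hHJH]
  · rw [Matrix.conjTranspose_mul, hJ]
    calc J * X * (Xᴴ * J) = J * (X * Xᴴ) * J := by simp only [mul_assoc]
      _ = J * H * (H * J) := by rw [h]; simp only [mul_assoc]
      _ = J * H := by rw [hcomm, ← mul_assoc, hJHJ]
  · rw [← mul_assoc, hJHJ]
  · simp only [Matrix.conjTranspose_mul, hJ, Matrix.conjTranspose_conjTranspose, mul_assoc]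
  · calc Xᴴ * J * J * X * (Xᴴ * J * J * X) = Xᴴ * J * J * (X * Xᴴ) * J * J * X := by
          simp only [mul_assoc]
      _ = Xᴴ * J * (J * H * (H * J)) * J * X := by rw [h]; simp only [mul_assoc]
      _ = Xᴴ * J * J * X := by
          rw [hcomm, ← mul_assoc (J * H), hJHJ, mul_assoc _ (J * H) J, hJHJ]

/-- Writing M = V†|M|, the factor K V† is again a contraction. With the next lemma, the trace norm
is the maximum of Re tr(K M) over contractions. -/
lemma trace_re_le_traceNorm {K M : Matrix n n ℂ} (hK : IsContraction K) :
    (K * M).trace.re ≤ traceNorm M := by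
  have hs := CFC.sqrt_nonneg (Mᴴ * M)
  have hp : 0 ≤ Mᴴ * M := by simpa using mul_conjTranspose_nonneg Mᴴ
  obtain ⟨V, h1, -, h2, h3⟩ := exists_polar (H := CFC.sqrt (Mᴴ * M)) (X := Mᴴ)
    (conjTranspose_sqrt _) (by rw [CFC.sqrt_mul_sqrt_self _ hp, Matrix.conjTranspose_conjTranspose])
  have hM : M = Vᴴ * CFC.sqrt (Mᴴ * M) := by
    conv_lhs => rw [← Matrix.conjTranspose_conjTranspose M, h1, Matrix.conjTranspose_mul,
      conjTranspose_sqrt]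
  conv_lhs => rw [hM, ← mul_assoc]
  exact (hK.mul h3).trace_re_mul_le hs

lemma exists_trace_re_eq_traceNorm (M : Matrix n n ℂ) :
    ∃ U, IsContraction U ∧ IsContraction Uᴴ ∧ (U * M).trace.re = traceNorm M := by
  have hp : 0 ≤ Mᴴ * M := by simpa using mul_conjTranspose_nonneg Mᴴ
  obtain ⟨V, -, h1, h2, h3⟩ := exists_polar (H := CFC.sqrt (Mᴴ * M)) (X := Mᴴ)
    (conjTranspose_sqrt _) (by rw [CFC.sqrt_mul_sqrt_self _ hp, Matrix.conjTranspose_conjTranspose])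
  rw [Matrix.conjTranspose_conjTranspose] at h1
  exact ⟨V, h2, h3, by rw [h1, traceNorm]⟩

/-- An overlap of purifications is bounded by the fidelity. -/
lemma trace_re_mul_sqrt_mul_le {U ρ σ Y : Matrix n n ℂ} (hU : IsContraction U)
    (hY : Y * Yᴴ = σ) :
    (U * (CFC.sqrt ρ * Y)).trace.re ≤ traceNorm (CFC.sqrt ρ * CFC.sqrt σ) := by
  have hσ : 0 ≤ σ := hY ▸ mul_conjTranspose_nonneg Y
  -- Y = √σ W, and cyclicity of the trace moves W next to U.
  obtain ⟨W, h1, -, h2, h3⟩ := exists_polar (H := CFC.sqrt σ) (X := Y)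
    (conjTranspose_sqrt _) (by rw [CFC.sqrt_mul_sqrt_self _ hσ, hY])
  have e : (U * (CFC.sqrt ρ * Y)).trace = (W * U * (CFC.sqrt ρ * CFC.sqrt σ)).trace := by
    rw [mul_assoc W, Matrix.trace_mul_comm W, h1]
    simp only [mul_assoc]
  rw [e]
  exact trace_re_le_traceNorm (h2.mul hU)

/-! ### Frobenius inner product -/

lemma trace_re_conjTranspose_mul_comm (X Y : Matrix n n ℂ) :
    (Xᴴ * Y).trace.re = (Yᴴ * X).trace.re := by
  rw [← trace_re_conjTranspose, Matrix.conjTranspose_mul, Matrix.conjTranspose_conjTranspose]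

lemma trace_re_conjTranspose_mul_self_nonneg (X : Matrix n n ℂ) : 0 ≤ (Xᴴ * X).trace.re :=
  trace_re_nonneg (by simpa using mul_conjTranspose_nonneg Xᴴ)

/-- Cauchy–Schwarz, from the discriminant of t ↦ ‖X + tY‖². -/
lemma trace_re_conjTranspose_mul_sq_le (X Y : Matrix n n ℂ) :
    (Xᴴ * Y).trace.re ^ 2 ≤ (Xᴴ * X).trace.re * (Yᴴ * Y).trace.re := by
  have h : ∀ t : ℝ, 0 ≤ (Yᴴ * Y).trace.re * (t * t) + 2 * (Xᴴ * Y).trace.re * t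
      + (Xᴴ * X).trace.re := by
    intro t
    have h1 := trace_re_conjTranspose_mul_self_nonneg (X + t • Y)
    have h2 := trace_re_conjTranspose_mul_comm Y X
    simp only [Matrix.conjTranspose_add, Matrix.conjTranspose_smul, star_trivial, add_mul, mul_add,
      Matrix.smul_mul, Matrix.mul_smul, Matrix.trace_add, Matrix.trace_smul, Complex.add_re,
      Complex.smul_re, smul_eq_mul, h2] at h1
    linarith
  have := discrim_le_zero h
  rw [discrim] at this
  nlinarith

/-- The left side equals Re⟨S + T, P(S - T)⟩, where ‖S + T‖² ≤ 4 and ‖S - T‖² ≤ 2ε². Cauchy–Schwarz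
gives 2√2 ε, rounded up to 3ε. -/
lemma trace_re_projection_mul_sub_le {P S T : Matrix n n ℂ} {ε : ℝ} (hε : 0 ≤ ε)
    (hP : Pᴴ = P) (hPP : P * P = P) (hS : (S * Sᴴ).trace.re ≤ 1) (hT : (T * Tᴴ).trace.re ≤ 1)
    (h : 1 - ε ^ 2 ≤ (Sᴴ * T).trace.re) :
    (P * (S * Sᴴ - T * Tᴴ)).trace.re ≤ 3 * ε := by
  have hcomm := trace_re_conjTranspose_mul_comm T S
  rw [Matrix.trace_mul_comm] at hS hT
  have hcommP : (Tᴴ * (P * S)).trace.re = (Sᴴ * (P * T)).trace.re := by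
    rw [trace_re_conjTranspose_mul_comm, Matrix.conjTranspose_mul, hP, mul_assoc]
  have hD : ((S - T)ᴴ * (S - T)).trace.re =
      (Sᴴ * S).trace.re + (Tᴴ * T).trace.re - 2 * (Sᴴ * T).trace.re := by
    simp only [Matrix.conjTranspose_sub, sub_mul, mul_sub, Matrix.trace_sub, Complex.sub_re, hcomm]
    ring
  have hE : ((S + T)ᴴ * (S + T)).trace.re =
      (Sᴴ * S).trace.re + (Tᴴ * T).trace.re + 2 * (Sᴴ * T).trace.re := by
    simp only [Matrix.conjTranspose_add, add_mul, mul_add, Matrix.trace_add, Complex.add_re, hcomm]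
    ring
  have hq : (P * (S * Sᴴ - T * Tᴴ)).trace.re = ((S + T)ᴴ * (P * (S - T))).trace.re := by
    simp only [Matrix.conjTranspose_add, add_mul, mul_sub, Matrix.trace_sub, Matrix.trace_add,
      Complex.sub_re, Complex.add_re, hcommP]
    rw [← mul_assoc, ← mul_assoc, Matrix.trace_mul_comm _ Sᴴ, Matrix.trace_mul_comm _ Tᴴ]
    ring
  have hPD : ((P * (S - T))ᴴ * (P * (S - T))).trace.re ≤ ((S - T)ᴴ * (S - T)).trace.re := by
    have h1 : P ≤ 1 := by
      have := isContraction_of_projection (K := P) (P := P) (by rw [hP, hPP]) hPP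
      rwa [IsContraction, hP, hPP] at this
    have h2 := trace_re_mono (conj_mono h1 (S - T)ᴴ)
    rw [mul_one, Matrix.conjTranspose_conjTranspose] at h2
    rwa [Matrix.conjTranspose_mul, hP, mul_assoc, ← mul_assoc P P, hPP, ← mul_assoc]
  have hcs := trace_re_conjTranspose_mul_sq_le (S + T) (P * (S - T))
  have hD0 := trace_re_conjTranspose_mul_self_nonneg (S - T)
  have hE0 := trace_re_conjTranspose_mul_self_nonneg (S + T)
  rw [← hq] at hcs
  have h8 : (P * (S * Sᴴ - T * Tᴴ)).trace.re ^ 2 ≤ 4 * (2 * ε ^ 2) := by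
    refine hcs.trans (mul_le_mul (by linarith) (by linarith) ?_ (by norm_num))
    exact trace_re_conjTranspose_mul_self_nonneg _
  refine abs_le_of_sq_le_sq' (h8.trans ?_) (by positivity) |>.2
  nlinarith [sq_nonneg ε]

/-- A form of the Fuchs–van de Graaf inequality: states of large fidelity are close. -/
lemma trace_re_projection_mul_sub_le_of_overlap {P U ρ σ : Matrix n n ℂ} {ε : ℝ} (hε : 0 ≤ ε)
    (hP : Pᴴ = P) (hPP : P * P = P) (hU : IsContraction U) (hρ : 0 ≤ ρ) (hσ : 0 ≤ σ)
    (hρ1 : ρ.trace.re ≤ 1) (hσ1 : σ.trace.re ≤ 1)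
    (h : 1 - ε ^ 2 ≤ (U * (CFC.sqrt ρ * CFC.sqrt σ)).trace.re) :
    (P * (ρ - σ)).trace.re ≤ 3 * ε := by
  have hS : CFC.sqrt ρ * (CFC.sqrt ρ)ᴴ = ρ := by
    rw [conjTranspose_sqrt, CFC.sqrt_mul_sqrt_self ρ hρ]
  -- U is only a contraction, so T T† ≤ σ rather than equality; this suffices because σ enters with
  -- a minus sign.
  have hT : (CFC.sqrt σ * U) * (CFC.sqrt σ * U)ᴴ ≤ σ := by
    have := conj_mono hU (CFC.sqrt σ)
    rw [mul_one, conjTranspose_sqrt, CFC.sqrt_mul_sqrt_self σ hσ] at this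
    rw [Matrix.conjTranspose_mul, conjTranspose_sqrt]
    simpa only [mul_assoc] using this
  have hP0 : 0 ≤ P := by simpa [hP, hPP] using mul_conjTranspose_nonneg P
  have key := trace_re_projection_mul_sub_le (S := CFC.sqrt ρ) (T := CFC.sqrt σ * U) hε hP hPP
    (by rwa [hS]) ((trace_re_mono hT).trans hσ1)
    (by rwa [conjTranspose_sqrt, ← mul_assoc, Matrix.trace_mul_comm])
  rw [hS] at key
  exact (trace_re_mul_mono hP0 (sub_le_sub_left hT ρ)).trans key

/-! ### Partial trace -/

lemma trace_reduceA (M : Matrix (A × B) (A × B) ℂ) : (reduceA M).trace = M.trace := by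
  simp [reduceA, Matrix.trace, Fintype.sum_prod_type]

lemma kronecker_one_mul_apply (P : Matrix A A ℂ) (M : Matrix (A × B) (A × B) ℂ) (a : A) (b : B)
    (c : A × B) : ((P ⊗ₖ (1 : Matrix B B ℂ)) * M) (a, b) c = ∑ a', P a a' * M (a', b) c := by
  simp [Matrix.mul_apply, Matrix.kroneckerMap_apply, Fintype.sum_prod_type, Matrix.one_apply]

lemma reduceA_kronecker_one_mul (P : Matrix A A ℂ) (M : Matrix (A × B) (A × B) ℂ) :
    reduceA ((P ⊗ₖ (1 : Matrix B B ℂ)) * M) = P * reduceA M := by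
  ext a a'
  simp only [reduceA, Matrix.of_apply, kronecker_one_mul_apply]
  simp only [Matrix.mul_apply, Matrix.of_apply, Finset.mul_sum]
  exact Finset.sum_comm

lemma trace_kronecker_one_mul (P : Matrix A A ℂ) (M : Matrix (A × B) (A × B) ℂ) :
    ((P ⊗ₖ (1 : Matrix B B ℂ)) * M).trace = (P * reduceA M).trace := by
  rw [← trace_reduceA, reduceA_kronecker_one_mul]

lemma reduceA_sub (M N : Matrix (A × B) (A × B) ℂ) :
    reduceA (M - N) = reduceA M - reduceA N := by
  ext; simp [reduceA]

lemma reduceA_nonneg {M : Matrix (A × B) (A × B) ℂ} (hM : 0 ≤ M) : 0 ≤ reduceA M := by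
  have : reduceA M = ∑ b, M.submatrix (fun a => (a, b)) (fun a => (a, b)) := by
    ext; simp [reduceA, Matrix.sum_apply]
  rw [this]
  exact Finset.sum_nonneg fun b _ => Matrix.nonneg_iff_posSemidef.mpr
    ((Matrix.nonneg_iff_posSemidef.mp hM).submatrix _)

/-- The operator `1 ⊗ |c⟩⟨b|`. -/
def shiftB (A : Type*) [DecidableEq A] {B : Type*} [DecidableEq B] (c b : B) :
    Matrix (A × B) (A × B) ℂ :=
  (1 : Matrix A A ℂ) ⊗ₖ Matrix.single c b 1

lemma conjTranspose_shiftB (c b : B) : (shiftB A c b)ᴴ = shiftB A b c := by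
  simp [shiftB, Matrix.conjTranspose_kronecker]

lemma shiftB_conj_apply (M : Matrix (A × B) (A × B) ℂ) (c b d e : B) (x y : A × B) :
    (shiftB A c b * M * shiftB A d e) x y =
      if x.2 = c ∧ y.2 = e then M (x.1, b) (y.1, d) else 0 := by
  obtain ⟨x1, x2⟩ := x
  obtain ⟨y1, y2⟩ := y
  simp only [shiftB, Matrix.mul_apply, Matrix.kroneckerMap_apply, Fintype.sum_prod_type,
    Matrix.one_apply, Matrix.single_apply]
  by_cases h1 : x2 = c <;> by_cases h2 : y2 = e <;>
    simp [h1, h2, eq_comm (a := c), eq_comm (a := e), Finset.sum_ite_eq]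

lemma smul_nonneg_matrix {r : ℝ} (hr : 0 ≤ r) {M : Matrix n n ℂ} (hM : 0 ≤ M) : 0 ≤ r • M :=
  Matrix.nonneg_iff_posSemidef.mpr ((Matrix.nonneg_iff_posSemidef.mp hM).smul hr)

lemma smul_le_smul_matrix {r : ℝ} (hr : 0 ≤ r) {M N : Matrix n n ℂ} (h : M ≤ N) :
    r • M ≤ r • N := by
  have := smul_nonneg_matrix hr (sub_nonneg.mpr h)
  rwa [smul_sub, sub_nonneg] at this

/-- Expand the positive operator ∑ᵢⱼ (Kᵢ - Kⱼ) M (Kᵢ - Kⱼ)†. -/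
lemma sum_conj_sum_le {ι : Type*} [Fintype ι] {M : Matrix n n ℂ} (hM : 0 ≤ M)
    (K : ι → Matrix n n ℂ) :
    (∑ i, K i) * M * (∑ i, K i)ᴴ ≤ (Fintype.card ι : ℝ) • ∑ i, K i * M * (K i)ᴴ := by
  have key : ∑ i, ∑ j, (K i - K j) * M * (K i - K j)ᴴ = (2 : ℝ) •
      ((Fintype.card ι : ℝ) • ∑ i, K i * M * (K i)ᴴ - (∑ i, K i) * M * (∑ i, K i)ᴴ) := by
    have e : (∑ i, K i) * M * (∑ i, K i)ᴴ = ∑ i, ∑ j, K i * M * (K j)ᴴ := by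
      simp only [Matrix.conjTranspose_sum, Finset.sum_mul, Finset.mul_sum]
      rw [Finset.sum_comm]
    have e' : ∑ i, ∑ j, K j * M * (K i)ᴴ = ∑ i, ∑ j, K i * M * (K j)ᴴ := Finset.sum_comm
    simp only [Matrix.conjTranspose_sub, sub_mul, mul_sub, Finset.sum_sub_distrib, Finset.sum_const,
      Finset.card_univ, ← Finset.smul_sum, e, e', ← Nat.cast_smul_eq_nsmul ℝ]
    module
  have h0 : 0 ≤ ∑ i, ∑ j, (K i - K j) * M * (K i - K j)ᴴ :=
    Finset.sum_nonneg fun i _ => Finset.sum_nonneg fun j _ => conj_nonneg hM _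
  have := smul_nonneg_matrix (r := 1 / 2) (by norm_num) h0
  rwa [key, smul_smul, one_div, inv_mul_cancel₀ two_ne_zero, one_smul, sub_nonneg] at this

/-- The pinching inequality `ρ ≤ |B| ρ_A ⊗ 1`. -/
lemma le_card_smul_reduceA_kronecker_one {M : Matrix (A × B) (A × B) ℂ} (hM : 0 ≤ M) :
    M ≤ (Fintype.card B : ℝ) • (reduceA M ⊗ₖ (1 : Matrix B B ℂ)) := by
  have h1 : ∑ b, shiftB A b b = (1 : Matrix (A × B) (A × B) ℂ) := by
    ext x y
    simp [shiftB, Matrix.sum_apply, Matrix.kroneckerMap_apply, Matrix.one_apply, Matrix.single_apply,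
      Prod.ext_iff, ite_and]
    split_ifs <;> rfl
  have h2 : reduceA M ⊗ₖ (1 : Matrix B B ℂ) =
      ∑ c, ∑ b, shiftB A c b * M * (shiftB A c b)ᴴ := by
    ext x y
    simp only [Matrix.sum_apply, conjTranspose_shiftB, shiftB_conj_apply, Matrix.kroneckerMap_apply,
      reduceA, Matrix.of_apply, Matrix.one_apply]
    by_cases h : x.2 = y.2
    · simp [h]
    · have : ∀ c, ¬(x.2 = c ∧ y.2 = c) := fun c hc => h (hc.1.trans hc.2.symm)
      simp [h, this]
  have h3 := sum_conj_sum_le hM fun b => shiftB A b b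
  rw [h1, one_mul, Matrix.conjTranspose_one, mul_one] at h3
  refine h3.trans (smul_le_smul_matrix (Nat.cast_nonneg _) ?_)
  rw [h2]
  -- The pinched operator consists of the terms b = c of the positive double sum.
  refine Finset.sum_le_sum fun c _ => ?_
  exact Finset.single_le_sum (f := fun b => shiftB A c b * M * (shiftB A c b)ᴴ)
    (fun b _ => conj_nonneg hM _) (Finset.mem_univ c)

/-! ### Capping the spectrum of an operator -/

lemma smul_one_eq_cfc (r : ℝ) {H : Matrix n n ℂ} (hH : H.IsHermitian) :
    r • (1 : Matrix n n ℂ) = cfc (fun _ : ℝ => r) H := by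
  rw [cfc_const r H hH.isSelfAdjoint, Algebra.algebraMap_eq_smul_one]

/-- G = g(H) with g = 1 up to μ and g(x) = √(μ/x) beyond; P is the spectral projection of H above μ.
For x > μ, √(μ/x) ≥ μ/x gives x - g(x)x ≤ x - μ, and ω ≤ μ allows μ to be replaced by ω under P. -/
lemma exists_capping {H ω : Matrix n n ℂ} {μ : ℝ} (hH : 0 ≤ H) (hμ : 0 < μ)
    (hω : ω ≤ μ • (1 : Matrix n n ℂ)) :
    ∃ G P : Matrix n n ℂ, Gᴴ = G ∧ IsContraction G ∧ Pᴴ = P ∧ P * P = P ∧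
      G * H * G ≤ μ • (1 : Matrix n n ℂ) ∧
      H.trace.re - (G * H).trace.re ≤ (P * (H - ω)).trace.re := by
  have hHh : H.IsHermitian := (Matrix.nonneg_iff_posSemidef.mp hH).1
  set g : ℝ → ℝ := fun x => if x ≤ μ then 1 else √(μ / x) with hg
  set p : ℝ → ℝ := fun x => if x ≤ μ then 0 else 1 with hp
  have hPh : (cfc p H)ᴴ = cfc p H := conjTranspose_cfc p H
  have hGh : (cfc g H)ᴴ = cfc g H := conjTranspose_cfc g H
  have hPP : cfc p H * cfc p H = cfc p H := by
    rw [← cfc_mul_matrix]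
    congr 1; ext x; by_cases hx : x ≤ μ <;> simp [p, hx]
  refine ⟨cfc g H, cfc p H, hGh, ?_, hPh, hPP, ?_, ?_⟩
  · rw [IsContraction, hGh, ← cfc_mul_matrix]
    refine cfc_le_one _ _ fun x _ => ?_
    by_cases hx : x ≤ μ
    · simp [g, hx]
    · have h0 : 0 < x := hμ.trans (not_le.mp hx)
      simp only [g, hx, if_false]
      rw [Real.mul_self_sqrt (by positivity), div_le_one h0]
      exact (not_le.mp hx).le
  · rw [cfc_mul_self_right g hHh, ← cfc_mul_matrix, smul_one_eq_cfc μ hHh]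
    refine cfc_mono (fun x _ => ?_) (continuousOn_spectrum _ _) (continuousOn_spectrum _ _)
    by_cases hx : x ≤ μ
    · simp [g, hx]
    · have h0 : 0 < x := hμ.trans (not_le.mp hx)
      simp only [g, hx, if_false]
      rw [mul_right_comm, Real.mul_self_sqrt (by positivity), div_mul_cancel₀ _ h0.ne']
  · have hP0 : 0 ≤ cfc p H := by simpa [hPh, hPP] using mul_conjTranspose_nonneg (cfc p H)
    have h1 : (cfc p H * (H - μ • (1 : Matrix n n ℂ))).trace.re ≤
        (cfc p H * (H - ω)).trace.re := trace_re_mul_mono hP0 (sub_le_sub_left hω H)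
    refine le_trans ?_ h1
    rw [← Complex.sub_re, ← Matrix.trace_sub]
    refine trace_re_mono ?_
    rw [mul_sub, cfc_mul_self_right g hHh, cfc_mul_self_right p hHh, smul_one_eq_cfc μ hHh,
      ← cfc_mul_matrix]
    nth_rewrite 1 [← cfc_id' ℝ H hHh.isSelfAdjoint]
    rw [← cfc_sub _ _ _ (continuousOn_spectrum _ _) (continuousOn_spectrum _ _),
      ← cfc_sub _ _ _ (continuousOn_spectrum _ _) (continuousOn_spectrum _ _)]
    refine cfc_mono (fun x _ => ?_) (continuousOn_spectrum _ _) (continuousOn_spectrum _ _)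
    by_cases hx : x ≤ μ
    · simp [g, p, hx]
    · have h0 : 0 < x := hμ.trans (not_le.mp hx)
      simp only [g, p, hx, if_false, one_mul]
      have h2 : μ / x ≤ √(μ / x) :=
        Real.le_sqrt_of_sq_le (by
          have : μ / x ≤ 1 := (div_le_one h0).mpr (not_le.mp hx).le
          have h3 : 0 ≤ μ / x := by positivity
          nlinarith)
      have := (div_le_iff₀ h0).mp h2
      linarith

/-! ### The smoothing step -/

lemma trace_re_sqrt_mul_le {ρ U : Matrix n n ℂ} (hρ : 0 ≤ ρ) (hU : IsContraction U) :
    ((CFC.sqrt ρ * U)ᴴ * (CFC.sqrt ρ * U)).trace.re ≤ ρ.trace.re := by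
  rw [Matrix.trace_mul_comm]
  refine trace_re_mono ?_
  have := conj_mono hU (CFC.sqrt ρ)
  rw [mul_one, conjTranspose_sqrt, CFC.sqrt_mul_sqrt_self ρ hρ] at this
  rw [Matrix.conjTranspose_mul, conjTranspose_sqrt]
  simpa only [mul_assoc] using this

/-- Cauchy–Schwarz at the optimal contraction. It serves to bound the trace of a state from below by
its fidelity with a normalized one. -/
lemma traceNorm_sqrt_mul_sqrt_sq_le {ρ σ : Matrix n n ℂ} (hρ : 0 ≤ ρ) (hσ : 0 ≤ σ) :
    traceNorm (CFC.sqrt ρ * CFC.sqrt σ) ^ 2 ≤ ρ.trace.re * σ.trace.re := by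
  obtain ⟨U, hU, hU', hUeq⟩ := exists_trace_re_eq_traceNorm (CFC.sqrt ρ * CFC.sqrt σ)
  have hcs := trace_re_conjTranspose_mul_sq_le (CFC.sqrt ρ * Uᴴ) (CFC.sqrt σ)
  rw [conjTranspose_sqrt σ, CFC.sqrt_mul_sqrt_self σ hσ, Matrix.conjTranspose_mul,
    conjTranspose_sqrt, Matrix.conjTranspose_conjTranspose, mul_assoc, hUeq] at hcs
  refine hcs.trans (mul_le_mul_of_nonneg_right ?_ (trace_re_nonneg hσ))
  have := trace_re_sqrt_mul_le hρ hU'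
  rwa [Matrix.conjTranspose_mul, conjTranspose_sqrt, Matrix.conjTranspose_conjTranspose] at this

lemma traceNorm_nonneg (M : Matrix n n ℂ) : 0 ≤ traceNorm M :=
  trace_re_nonneg (CFC.sqrt_nonneg _)

/-- Given an approximation `ρ'` of `ρ` and an approximation `ω` of the marginal of `ρ`, some local
filter on `A` takes `ρ'` to an approximation of `ρ` whose marginal is bounded like `ω`. -/
lemma exists_filter {ρ ρ' : Matrix (A × B) (A × B) ℂ} {ω : Matrix A A ℂ} {ε μ : ℝ}
    (hε : 0 ≤ ε) (hε1 : ε ≤ 1) (hμ : 0 < μ) (hρ : 0 ≤ ρ) (hρ' : 0 ≤ ρ') (hω : 0 ≤ ω)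
    (hρ1 : ρ.trace.re = 1) (hρ1' : ρ'.trace.re ≤ 1) (hω1 : ω.trace.re ≤ 1)
    (h : 1 - ε ^ 2 ≤ traceNorm (CFC.sqrt ρ * CFC.sqrt ρ'))
    (hA : 1 - ε ^ 2 ≤ traceNorm (CFC.sqrt (reduceA ρ) * CFC.sqrt ω))
    (hωμ : ω ≤ μ • (1 : Matrix A A ℂ)) :
    ∃ G : Matrix A A ℂ, Gᴴ = G ∧ IsContraction (G ⊗ₖ (1 : Matrix B B ℂ)) ∧
      G * reduceA ρ' * G ≤ μ • (1 : Matrix A A ℂ) ∧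
      1 - 8 * ε - 2 * ε ^ 2 ≤ traceNorm (CFC.sqrt ρ *
        CFC.sqrt ((G ⊗ₖ (1 : Matrix B B ℂ)) * ρ' * (G ⊗ₖ (1 : Matrix B B ℂ)))) := by
  obtain ⟨U, hU, hU', hUeq⟩ := exists_trace_re_eq_traceNorm (CFC.sqrt ρ * CFC.sqrt ρ')
  obtain ⟨V, hV, hV', hVeq⟩ := exists_trace_re_eq_traceNorm (CFC.sqrt (reduceA ρ) * CFC.sqrt ω)
  obtain ⟨G, P, hG, hGc, hP, hPP, hGμ, hGP⟩ := exists_capping (reduceA_nonneg hρ') hμ hωμ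
  set K := G ⊗ₖ (1 : Matrix B B ℂ) with hK
  have hKh : Kᴴ = K := by simp [hK, Matrix.conjTranspose_kronecker, hG]
  have hKc : IsContraction K := by
    rw [IsContraction, hKh, hK, ← Matrix.mul_kronecker_mul, mul_one, ← Matrix.one_kronecker_one,
      ← sub_nonneg]
    rw [IsContraction, hG] at hGc
    rw [show (1 : Matrix A A ℂ) ⊗ₖ (1 : Matrix B B ℂ) - (G * G) ⊗ₖ (1 : Matrix B B ℂ) =
      (1 - G * G) ⊗ₖ (1 : Matrix B B ℂ) by
        rw [sub_eq_iff_eq_add, ← Matrix.add_kronecker, sub_add_cancel]]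
    exact Matrix.nonneg_iff_posSemidef.mpr
      ((Matrix.nonneg_iff_posSemidef.mp (sub_nonneg.mpr hGc)).kronecker Matrix.PosSemidef.one)
  refine ⟨G, hG, hKc, hGμ, ?_⟩
  set R := CFC.sqrt ρ * Uᴴ with hR
  set N := CFC.sqrt ρ' with hN
  have hNh : Nᴴ = N := conjTranspose_sqrt ρ'
  have hNN : N * N = ρ' := CFC.sqrt_mul_sqrt_self ρ' hρ'
  have hRh : Rᴴ = U * CFC.sqrt ρ := by
    rw [hR, Matrix.conjTranspose_mul, conjTranspose_sqrt, Matrix.conjTranspose_conjTranspose]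
  have hRR : (Rᴴ * R).trace.re ≤ 1 := by
    rw [← hρ1]
    exact trace_re_sqrt_mul_le hρ hU'
  have hRN : 1 - ε ^ 2 ≤ (Rᴴ * N).trace.re := by rwa [hRh, mul_assoc, hUeq]
  have hNN1 : (Nᴴ * N).trace.re ≤ 1 := by rwa [hNh, hNN]
  have hup := trace_re_mul_sqrt_mul_le (ρ := ρ) (σ := K * ρ' * K) (Y := K * N) hU
    (by rw [Matrix.conjTranspose_mul, hKh, hNh, ← hNN]; simp only [mul_assoc])
  refine le_trans ?_ hup
  have hNR : ((N - R)ᴴ * (N - R)).trace.re ≤ 2 * ε ^ 2 := by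
    have := trace_re_conjTranspose_mul_comm N R
    simp only [Matrix.conjTranspose_sub, sub_mul, mul_sub, Matrix.trace_sub, Complex.sub_re, this]
    linarith
  have hKN : ((K * N)ᴴ * (K * N)).trace.re ≤ 1 := by
    have := trace_re_mono (conj_mono hKc Nᴴ)
    rw [mul_one, Matrix.conjTranspose_conjTranspose] at this
    rw [Matrix.conjTranspose_mul]
    rw [hKh] at this ⊢
    simp only [mul_assoc] at this ⊢
    exact this.trans hNN1
  -- Cauchy–Schwarz gives √2 ε, rounded up.
  have h1 : ((N - R)ᴴ * (K * N)).trace.re ≤ 2 * ε := by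
    have hcs := trace_re_conjTranspose_mul_sq_le (N - R) (K * N)
    have h0 := trace_re_conjTranspose_mul_self_nonneg (N - R)
    have h0' := trace_re_conjTranspose_mul_self_nonneg (K * N)
    exact (abs_le_of_sq_le_sq' (by nlinarith) (by positivity)).2
  -- Triangle inequality through ρ_A. The first term is tested on A × B with P ⊗ 1, so monotonicity
  -- of the fidelity under partial trace is not needed.
  have h2 : (P * (reduceA ρ' - ω)).trace.re ≤ 3 * ε + 3 * ε := by
    have e : P * (reduceA ρ' - ω) = P * (reduceA (ρ' - ρ)) + P * (reduceA ρ - ω) := by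
      rw [reduceA_sub]; noncomm_ring
    rw [e, Matrix.trace_add, Complex.add_re]
    refine add_le_add ?_ ?_
    · rw [← trace_kronecker_one_mul]
      refine trace_re_projection_mul_sub_le_of_overlap (U := Uᴴ) hε ?_ ?_ hU' hρ' hρ hρ1' hρ1.le ?_
      · simp [Matrix.conjTranspose_kronecker, hP]
      · rw [← Matrix.mul_kronecker_mul, hPP, mul_one]
      · rw [← trace_re_conjTranspose]
        rw [← hUeq] at h
        simpa only [Matrix.conjTranspose_mul, Matrix.conjTranspose_conjTranspose,
          conjTranspose_sqrt, Matrix.trace_mul_comm _ U] using h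
    · refine trace_re_projection_mul_sub_le_of_overlap hε hP hPP hV (reduceA_nonneg hρ) hω ?_ hω1 ?_
      · rw [trace_reduceA, hρ1]
      · rwa [hVeq]
  have h3 : 1 - 2 * ε ^ 2 ≤ ρ'.trace.re := by
    have hsq := traceNorm_sqrt_mul_sqrt_sq_le hρ hρ'
    rw [hρ1, one_mul] at hsq
    have h4 : 0 ≤ 1 - ε ^ 2 := by nlinarith
    nlinarith
  have h4 : (Nᴴ * (K * N)).trace.re = (G * reduceA ρ').trace.re := by
    rw [← trace_kronecker_one_mul, hNh, Matrix.trace_mul_comm, mul_assoc, hNN]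
  have h5 : (U * (CFC.sqrt ρ * (K * N))).trace.re =
      (Nᴴ * (K * N)).trace.re - ((N - R)ᴴ * (K * N)).trace.re := by
    rw [← mul_assoc, ← hRh, Matrix.conjTranspose_sub, sub_mul, Matrix.trace_sub, Complex.sub_re]
    ring
  rw [trace_reduceA] at hGP
  rw [h5, h4]
  linarith

/-! ### States and balls -/

lemma reduceA_mem_normalizedStates {ρ : Matrix (A × B) (A × B) ℂ}
    (hρ : ρ ∈ normalizedStates (A × B)) : reduceA ρ ∈ normalizedStates A :=
  ⟨Matrix.nonneg_iff_posSemidef.mp (reduceA_nonneg (Matrix.nonneg_iff_posSemidef.mpr hρ.1)),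
    by rw [trace_reduceA, hρ.2]⟩

lemma fidelity_eq_traceNorm {ρ σ : Matrix n n ℂ} (hρ : ρ ∈ normalizedStates n) :
    fidelity ρ σ = traceNorm (CFC.sqrt ρ * CFC.sqrt σ) := by
  simp [fidelity, hρ.2]

lemma purifiedDistance_le_iff {ρ σ : Matrix n n ℂ} (hρ : ρ ∈ normalizedStates n) {δ : ℝ}
    (hδ : 0 ≤ δ) :
    purifiedDistance ρ σ ≤ δ ↔ 1 - δ ^ 2 ≤ traceNorm (CFC.sqrt ρ * CFC.sqrt σ) ^ 2 := by
  rw [purifiedDistance, fidelity_eq_traceNorm hρ, Real.sqrt_le_left hδ, sub_le_comm]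

lemma self_mem_stateBall {ρ : Matrix n n ℂ} (hρ : ρ ∈ normalizedStates n) {δ : ℝ} (hδ : 0 ≤ δ) :
    ρ ∈ stateBall δ ρ := by
  have h0 : 0 ≤ ρ := Matrix.nonneg_iff_posSemidef.mpr hρ.1
  refine ⟨⟨hρ.1, by simp [hρ.2], by simp [hρ.2]⟩, (purifiedDistance_le_iff hρ hδ).mpr ?_⟩
  rw [CFC.sqrt_mul_sqrt_self ρ h0, traceNorm, hρ.1.1.eq, CFC.sqrt_mul_self ρ h0, hρ.2]
  simp only [Complex.one_re]
  nlinarith [sq_nonneg δ]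

lemma one_sub_sq_le_trace_of_mem_stateBall {ρ ρ' : Matrix n n ℂ} (hρ : ρ ∈ normalizedStates n)
    {δ : ℝ} (hδ : 0 ≤ δ) (h : ρ' ∈ stateBall δ ρ) : 1 - δ ^ 2 ≤ ρ'.trace.re := by
  have h1 := (purifiedDistance_le_iff hρ hδ).mp h.2
  have h2 := traceNorm_sqrt_mul_sqrt_sq_le (Matrix.nonneg_iff_posSemidef.mpr hρ.1)
    (Matrix.nonneg_iff_posSemidef.mpr h.1.1)
  rw [hρ.2, Complex.one_re, one_mul] at h2
  exact h1.trans h2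

/-- For δ ≤ 1, √(1 - δ²) ≥ 1 - δ²; this weaker bound keeps later estimates polynomial. -/
lemma one_sub_sq_le_traceNorm_of_mem_stateBall {ρ ρ' : Matrix n n ℂ}
    (hρ : ρ ∈ normalizedStates n) {δ : ℝ} (hδ : 0 ≤ δ) (hδ1 : δ ≤ 1) (h : ρ' ∈ stateBall δ ρ) :
    1 - δ ^ 2 ≤ traceNorm (CFC.sqrt ρ * CFC.sqrt ρ') := by
  have h1 := (purifiedDistance_le_iff hρ hδ).mp h.2
  have h2 := traceNorm_nonneg (CFC.sqrt ρ * CFC.sqrt ρ')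
  refine abs_le_of_sq_le_sq' (le_trans ?_ h1) h2 |>.2
  have : 0 ≤ 1 - δ ^ 2 := by nlinarith
  nlinarith [sq_nonneg δ]

lemma uniform_mem_normalizedStates [Nonempty n] :
    ((Fintype.card n : ℝ)⁻¹ • (1 : Matrix n n ℂ)) ∈ normalizedStates n := by
  refine ⟨Matrix.PosSemidef.one.smul (by positivity), ?_⟩
  rw [Matrix.trace_smul, Matrix.trace_one]
  simp

lemma nonempty_of_mem_normalizedStates {ρ : Matrix n n ℂ} (hρ : ρ ∈ normalizedStates n) :
    Nonempty n := by
  by_contra h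
  rw [not_nonempty_iff] at h
  simpa [Matrix.trace] using hρ.2

/-! ### Entropies -/

lemma maxRelEntropy_le {ρ σ : Matrix n n ℂ} {lam : ℝ} (h : ρ ≤ (2 : ℝ) ^ lam • σ) :
    maxRelEntropy ρ σ ≤ lam :=
  iInf₂_le lam h

lemma le_maxRelEntropy {ρ σ : Matrix n n ℂ} {c : ℝ}
    (h : ∀ lam : ℝ, ρ ≤ (2 : ℝ) ^ lam • σ → c ≤ lam) : (c : EReal) ≤ maxRelEntropy ρ σ :=
  le_iInf₂ fun lam hlam => EReal.coe_le_coe_iff.mpr (h lam hlam)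

lemma trace_re_smul_one (r : ℝ) :
    (r • (1 : Matrix n n ℂ)).trace.re = r * Fintype.card n := by
  simp [Matrix.trace_smul]

lemma le_sSup_spectrum_smul_one {ω : Matrix n n ℂ} (hω : ω.IsHermitian) :
    ω ≤ sSup (spectrum ℝ ω) • (1 : Matrix n n ℂ) := by
  rw [← Algebra.algebraMap_eq_smul_one]
  exact le_algebraMap_of_spectrum_le
    (fun x hx => le_csSup ω.finite_real_spectrum.bddAbove hx) hω.isSelfAdjoint

/-- Positive trace forces a positive largest eigenvalue, so the logarithm inverts properly. -/
lemma le_two_rpow_neg_minEntropy {ω : Matrix n n ℂ} (hω : ω ∈ subnormalizedStates n) :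
    ω ≤ (2 : ℝ) ^ (-minEntropy ω) • (1 : Matrix n n ℂ) := by
  have h := le_sSup_spectrum_smul_one hω.1.1
  have h1 := trace_re_mono h
  rw [trace_re_smul_one] at h1
  have hpos : 0 < sSup (spectrum ℝ ω) :=
    pos_of_mul_pos_left (hω.2.1.trans_le h1) (Nat.cast_nonneg _)
  rwa [minEntropy, neg_neg, Real.rpow_logb two_pos (by norm_num) hpos]

lemma minEntropy_le {ω : Matrix n n ℂ} (hω : ω ∈ subnormalizedStates n) {t : ℝ} (ht : 0 < t)
    (h : t ≤ ω.trace.re) : minEntropy ω ≤ -Real.logb 2 (t / Fintype.card n) := by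
  have h1 := trace_re_mono (le_two_rpow_neg_minEntropy hω)
  rw [trace_re_smul_one] at h1
  have hn : (0 : ℝ) < Fintype.card n :=
    pos_of_mul_pos_right (ht.trans_le (h.trans h1)) (by positivity)
  rw [le_neg, Real.logb_le_iff_le_rpow one_lt_two (by positivity), div_le_iff₀ hn]
  exact h.trans h1

lemma trace_re_smul_kronecker {M : Matrix A A ℂ} {σ : Matrix B B ℂ} (hσ : σ ∈ normalizedStates B)
    (r : ℝ) : (r • (M ⊗ₖ σ)).trace.re = r * M.trace.re := by
  rw [Matrix.trace_smul, Matrix.trace_kronecker, hσ.2, mul_one, Complex.smul_re, smul_eq_mul]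

lemma maxInfo₂_nonneg {ρ : Matrix (A × B) (A × B) ℂ} (hρ : ρ ∈ subnormalizedStates (A × B)) :
    0 ≤ maxInfo₂ ρ := by
  refine le_iInf₂ fun σ hσ => ?_
  rw [← EReal.coe_zero]
  refine le_maxRelEntropy fun lam h => ?_
  have h1 := trace_re_mono h
  rw [trace_re_smul_kronecker hσ, trace_reduceA] at h1
  have h2 : 1 ≤ (2 : ℝ) ^ lam := by
    have := hρ.2.1
    by_contra! hlt
    nlinarith
  by_contra! hlt
  exact absurd (Real.rpow_lt_one_of_one_lt_of_neg one_lt_two hlt) (not_lt.mpr h2)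

lemma condMinEntropy_le {ρ : Matrix (A × B) (A × B) ℂ} {t : ℝ} (ht : 0 < t)
    (h : t ≤ ρ.trace.re) :
    condMinEntropy ρ ≤ ((-Real.logb 2 (t / Fintype.card A) : ℝ) : EReal) := by
  rw [condMinEntropy, EReal.coe_neg, EReal.neg_le_neg_iff]
  refine le_iInf₂ fun σ hσ => le_maxRelEntropy fun lam hlam => ?_
  have h1 := trace_re_mono hlam
  rw [trace_re_smul_kronecker hσ, Matrix.trace_one, Complex.natCast_re] at h1
  have hn : (0 : ℝ) < Fintype.card A :=
    pos_of_mul_pos_right (ht.trans_le (h.trans h1)) (by positivity)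
  rw [Real.logb_le_iff_le_rpow one_lt_two (by positivity), div_le_iff₀ hn]
  exact h.trans h1

lemma kronecker_mono_left {M N : Matrix A A ℂ} {σ : Matrix B B ℂ} (h : M ≤ N) (hσ : 0 ≤ σ) :
    M ⊗ₖ σ ≤ N ⊗ₖ σ := by
  rw [← sub_nonneg, show N ⊗ₖ σ - M ⊗ₖ σ = (N - M) ⊗ₖ σ by
    rw [sub_eq_iff_eq_add, ← Matrix.add_kronecker, sub_add_cancel]]
  exact Matrix.nonneg_iff_posSemidef.mpr ((Matrix.nonneg_iff_posSemidef.mp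
    (sub_nonneg.mpr h)).kronecker (Matrix.nonneg_iff_posSemidef.mp hσ))

lemma exists_le_two_rpow_smul_reduceA_kronecker {ρ : Matrix (A × B) (A × B) ℂ}
    (hρ : ρ ∈ normalizedStates (A × B)) :
    ∃ lam : ℝ, ∃ σ ∈ normalizedStates B, ρ ≤ (2 : ℝ) ^ lam • (reduceA ρ ⊗ₖ σ) := by
  have : Nonempty B := (nonempty_of_mem_normalizedStates hρ).map Prod.snd
  have hB : (0 : ℝ) < Fintype.card B := by exact_mod_cast Fintype.card_pos
  -- With σ uniform, pinching costs |B| and the normalization of σ another |B|.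
  refine ⟨Real.logb 2 (Fintype.card B * Fintype.card B), _, uniform_mem_normalizedStates, ?_⟩
  rw [Real.rpow_logb two_pos (by norm_num) (by positivity), Matrix.kronecker_smul, smul_smul,
    mul_assoc, mul_inv_cancel₀ hB.ne', mul_one]
  exact le_card_smul_reduceA_kronecker_one (Matrix.nonneg_iff_posSemidef.mpr hρ.1)

/-- The filtered state certifies a lower bound on the smooth conditional min-entropy. -/
lemma minEntropy_sub_le_smoothCondMinEntropy {ρ ρ' : Matrix (A × B) (A × B) ℂ}
    {ω : Matrix A A ℂ} {σ : Matrix B B ℂ} {ε lam : ℝ} (hρ : ρ ∈ normalizedStates (A × B))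
    (hε : 0 ≤ ε) (hε' : 32 * ε < 1) (hρ' : ρ' ∈ stateBall ε ρ) (hω : ω ∈ stateBall ε (reduceA ρ))
    (hσ : σ ∈ normalizedStates B) (h : ρ' ≤ (2 : ℝ) ^ lam • (reduceA ρ' ⊗ₖ σ)) :
    ((minEntropy ω - lam : ℝ) : EReal) ≤ smoothCondMinEntropy (4 * √(2 * ε)) ρ := by
  have hρ0 : 0 ≤ ρ := Matrix.nonneg_iff_posSemidef.mpr hρ.1
  have hρ0' : 0 ≤ ρ' := Matrix.nonneg_iff_posSemidef.mpr hρ'.1.1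
  have hσ0 : 0 ≤ σ := Matrix.nonneg_iff_posSemidef.mpr hσ.1
  have hρA := reduceA_mem_normalizedStates hρ
  obtain ⟨G, hG, hKc, hGμ, hF⟩ := exists_filter hε (by linarith)
    (Real.rpow_pos_of_pos two_pos (-minEntropy ω)) hρ0 hρ0'
    (Matrix.nonneg_iff_posSemidef.mpr hω.1.1) (by rw [hρ.2, Complex.one_re]) hρ'.1.2.2 hω.1.2.2
    (one_sub_sq_le_traceNorm_of_mem_stateBall hρ hε (by linarith) hρ')
    (one_sub_sq_le_traceNorm_of_mem_stateBall hρA hε (by linarith) hω)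
    (le_two_rpow_neg_minEntropy hω.1)
  set K := G ⊗ₖ (1 : Matrix B B ℂ) with hK
  have hKh : Kᴴ = K := by simp [hK, Matrix.conjTranspose_kronecker, hG]
  have h0 : 0 ≤ K * ρ' * K := by simpa only [hKh] using conj_nonneg hρ0' K
  have hFpos : 0 < 1 - 8 * ε - 2 * ε ^ 2 := by nlinarith
  have hmem : K * ρ' * K ∈ stateBall (4 * √(2 * ε)) ρ := by
    refine ⟨⟨Matrix.nonneg_iff_posSemidef.mp h0, ?_, ?_⟩, ?_⟩
    · have := traceNorm_sqrt_mul_sqrt_sq_le hρ0 h0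
      rw [hρ.2, Complex.one_re, one_mul] at this
      exact lt_of_lt_of_le (pow_pos (hFpos.trans_le hF) 2) this
    · have := trace_re_mul_mono hρ0' hKc
      rw [mul_one, hKh, ← mul_assoc, Matrix.trace_mul_comm, ← mul_assoc] at this
      exact this.trans hρ'.1.2.2
    · rw [purifiedDistance_le_iff hρ (by positivity), mul_pow, Real.sq_sqrt (by positivity)]
      refine le_trans ?_ (pow_le_pow_left₀ hFpos.le hF 2)
      -- (1 - x)² ≥ 1 - 2x at x = 8ε + 2ε², and 16ε + 4ε² ≤ 32ε, the squared radius.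
      nlinarith [sq_nonneg (8 * ε + 2 * ε ^ 2)]
  have hle : K * ρ' * K ≤ (2 : ℝ) ^ (lam - minEntropy ω) • ((1 : Matrix A A ℂ) ⊗ₖ σ) := by
    have h1 := conj_mono h K
    rw [hKh] at h1
    refine h1.trans ?_
    have e : K * ((2 : ℝ) ^ lam • (reduceA ρ' ⊗ₖ σ)) * K =
        (2 : ℝ) ^ lam • ((G * reduceA ρ' * G) ⊗ₖ σ) := by
      rw [Matrix.mul_smul, Matrix.smul_mul, hK, ← Matrix.mul_kronecker_mul,
        ← Matrix.mul_kronecker_mul, one_mul, mul_one]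
    rw [e, sub_eq_add_neg, Real.rpow_add two_pos, ← smul_smul]
    have h2 := kronecker_mono_left hGμ hσ0
    rw [Matrix.smul_kronecker] at h2
    exact smul_le_smul_matrix (Real.rpow_nonneg two_pos.le lam) h2
  have hcond : ((minEntropy ω - lam : ℝ) : EReal) ≤ condMinEntropy (K * ρ' * K) := by
    rw [condMinEntropy, ← neg_sub lam, EReal.coe_neg, EReal.neg_le_neg_iff]
    exact (iInf₂_le σ hσ).trans (maxRelEntropy_le hle)
  exact hcond.trans (le_iSup₂ (f := fun τ (_ : τ ∈ stateBall (4 * √(2 * ε)) ρ) =>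
    condMinEntropy τ) _ hmem)

lemma exists_eq_coe {x : EReal} {a b : ℝ} (ha : (a : EReal) ≤ x) (hb : x ≤ b) :
    ∃ r : ℝ, x = r :=
  ⟨x.toReal, (EReal.coe_toReal (ne_top_of_le_ne_top (EReal.coe_ne_top b) hb)
    (ne_bot_of_le_ne_bot (EReal.coe_ne_bot a) ha)).symm⟩

end QInfo

theorem mainTheorem5 {A : Type*} {B : Type*} [Fintype A] [DecidableEq A] [Fintype B] [DecidableEq B]
    (ρ : Matrix (A × B) (A × B) ℂ) (hρ : ρ ∈ QInfo.normalizedStates (A × B))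
    (ε : ℝ) (hε : 0 ≤ ε) (hε' : 4 * √(2 * ε) < 1) :
    ∃ i h k : ℝ,
      QInfo.smoothMaxInfo₂ ε ρ = (i : EReal) ∧
      QInfo.smoothMinEntropy ε (QInfo.reduceA ρ) = (h : EReal) ∧
      QInfo.smoothCondMinEntropy (4 * √(2 * ε)) ρ = (k : EReal) ∧
      i ≥ h - k := by
  open QInfo in
  have hδ : 0 ≤ 4 * √(2 * ε) := by positivity
  have hsq : √(2 * ε) ^ 2 = 2 * ε := Real.sq_sqrt (by positivity)
  have h32 : 32 * ε < 1 := by nlinarith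
  have hρA := reduceA_mem_normalizedStates hρ
  have hself := self_mem_stateBall hρ hε
  have hselfA := self_mem_stateBall hρA hε
  obtain ⟨lam₀, σ₀, hσ₀, h₀⟩ := exists_le_two_rpow_smul_reduceA_kronecker hρ
  obtain ⟨i, hi⟩ : ∃ i : ℝ, smoothMaxInfo₂ ε ρ = i := by
    refine exists_eq_coe (a := 0) (b := lam₀) ?_ ?_
    · exact le_iInf₂ fun ρ' hρ' => maxInfo₂_nonneg hρ'.1
    · exact (iInf₂_le ρ hself).trans ((iInf₂_le σ₀ hσ₀).trans (maxRelEntropy_le h₀))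
  obtain ⟨h, hh⟩ : ∃ h : ℝ, smoothMinEntropy ε (reduceA ρ) = h := by
    refine exists_eq_coe (a := minEntropy (reduceA ρ)) ?_ (iSup₂_le fun ω hω =>
      EReal.coe_le_coe_iff.mpr (minEntropy_le hω.1 (t := 1 - ε ^ 2) (by nlinarith)
        (one_sub_sq_le_trace_of_mem_stateBall hρA hε hω)))
    exact le_iSup₂ (f := fun τ (_ : τ ∈ stateBall ε (reduceA ρ)) => (minEntropy τ : EReal)) _ hselfA
  obtain ⟨k, hk⟩ : ∃ k : ℝ, smoothCondMinEntropy (4 * √(2 * ε)) ρ = k :=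
    -- The lower bound is the filter estimate at ρ' = ρ and ω = ρ_A.
    exists_eq_coe (minEntropy_sub_le_smoothCondMinEntropy hρ hε h32 hself hselfA hσ₀ h₀)
      (iSup₂_le fun ρ' hρ' => condMinEntropy_le (t := 1 - (4 * √(2 * ε)) ^ 2) (by nlinarith)
        (one_sub_sq_le_trace_of_mem_stateBall hρ hδ hρ'))
  refine ⟨i, h, k, hi, hh, hk, ?_⟩
  have hle : (h : EReal) ≤ ((i + k : ℝ) : EReal) := by
    rw [← hh]
    refine iSup₂_le fun ω hω => EReal.coe_le_coe_iff.mpr ?_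
    -- With the real number k moved across, the claim is a lower bound on the iterated infimum
    -- defining i.
    suffices hs : ((minEntropy ω - k : ℝ) : EReal) ≤ i by
      linarith [EReal.coe_le_coe_iff.mp hs]
    rw [← hi]
    refine le_iInf₂ fun ρ' hρ' => le_iInf₂ fun σ hσ => le_maxRelEntropy fun lam hlam => ?_
    have := minEntropy_sub_le_smoothCondMinEntropy hρ hε h32 hρ' hω hσ hlam
    rw [hk] at this
    linarith [EReal.coe_le_coe_iff.mp this]
  linarith [EReal.coe_le_coe_iff.mp hle]
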